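/- There is a constant $C \in \mathbb{N}$ such that for every finite set $Ap$ of atomic propositions and every LTL formula $\varphi$ over $Ap$ (built from $\mathbf{tt}$, $\mathbf{ff}$ and the propositions of $Ap$ with $\neg, \wedge, \vee, \mathbf{X}, \mathbf{F}, \mathbf{G}, \mathbf{U}$) there is a deterministic parity automaton $\mathcal{A}$ over the alphabet $2^{Ap}$ with at most $2^{2^{C\cdot|\varphi|}}$ states (that is, with $2^{2^{\mathcal{O}(|\varphi|)}}$ states) that is equivalent to $\varphi$: for every $\omega$-word $w : \mathbb{N} \to 2^{Ap}$, $\mathcal{A}$ accepts $w$ if and only if $w \models \varphi$. Here a deterministic parity automaton has a finite set of states, an initial state, a total transition function and a color from $\{1, \dots, d\}$ (for some $d \in \mathbb{N}$) on every transition, and it accepts $w$ if and only if the minimal color that appears infinitely often along its run on $w$ is even; $|\varphi|$ is the number of distinct subformulas of $\varphi$, i.e. the number of nodes of its syntax DAG. (This number is at most the length of $\varphi$, so the bound also holds with the length of $\varphi$ in place of $|\varphi|$.) -/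

import Mathlib

/-- Formulas of linear temporal logic over a set `AP` of atomic propositions, in the usual syntax
(negation may be applied to every formula, not only to atoms). -/
inductive LTL (AP : Type*) where
  | tt : LTL AP
  | ff : LTL AP
  | atom (a : AP) : LTL AP
  | neg (φ : LTL AP) : LTL AP
  | and (φ ψ : LTL AP) : LTL AP
  | or (φ ψ : LTL AP) : LTL AP
  | next (φ : LTL AP) : LTL AP
  | finally_ (φ : LTL AP) : LTL AP
  | globally (φ : LTL AP) : LTL AP
  | until_ (φ ψ : LTL AP) : LTL AP

namespace LTL

variable {AP : Type*}

/-- The `ω`-word `w(k) w(k+1) w(k+2) …`. -/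
def suffix {S : Type*} (w : ℕ → S) (k : ℕ) : ℕ → S := fun i => w (k + i)

/-- Satisfaction of a formula by an `ω`-word over the alphabet `2^AP`. -/
def Sat : LTL AP → (ℕ → Set AP) → Prop
  | tt, _ => True
  | ff, _ => False
  | atom a, w => a ∈ w 0
  | neg φ, w => ¬ Sat φ w
  | and φ ψ, w => Sat φ w ∧ Sat ψ w
  | or φ ψ, w => Sat φ w ∨ Sat ψ w
  | next φ, w => Sat φ (suffix w 1)
  | finally_ φ, w => ∃ k, Sat φ (suffix w k)
  | globally φ, w => ∀ k, Sat φ (suffix w k)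
  | until_ φ ψ, w => ∃ k, Sat ψ (suffix w k) ∧ ∀ j < k, Sat φ (suffix w j)

/-- The language of a formula. -/
def language (φ : LTL AP) : Set (ℕ → Set AP) := {w | φ.Sat w}

/-- The set of subformulas of a formula (including the formula itself). -/
def subformulas : LTL AP → Set (LTL AP)
  | tt => {tt}
  | ff => {ff}
  | atom a => {atom a}
  | neg φ => insert (neg φ) φ.subformulas
  | and φ ψ => insert (and φ ψ) (φ.subformulas ∪ ψ.subformulas)
  | or φ ψ => insert (or φ ψ) (φ.subformulas ∪ ψ.subformulas)
  | next φ => insert (next φ) φ.subformulas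
  | finally_ φ => insert (finally_ φ) φ.subformulas
  | globally φ => insert (globally φ) φ.subformulas
  | until_ φ ψ => insert (until_ φ ψ) (φ.subformulas ∪ ψ.subformulas)

/-- The size `|φ|` of a formula: the number of nodes of its syntax DAG, in which all occurrences of
the same subformula share one node. -/
noncomputable def size (φ : LTL AP) : ℕ := φ.subformulas.ncard

/-- The length of a formula: the number of nodes of its syntax tree. -/
def length : LTL AP → ℕ
  | tt => 1
  | ff => 1
  | atom _ => 1
  | neg φ => φ.length + 1
  | and φ ψ => φ.length + ψ.length + 1
  | or φ ψ => φ.length + ψ.length + 1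
  | next φ => φ.length + 1
  | finally_ φ => φ.length + 1
  | globally φ => φ.length + 1
  | until_ φ ψ => φ.length + ψ.length + 1

/-- `size` counts the elements of a finite set, so it carries no junk value. -/
theorem finite_subformulas (φ : LTL AP) : φ.subformulas.Finite := by
  induction φ <;> simp_all [subformulas]

/-- A bound in terms of `size` is at least as strong as the same bound in terms of `length`. -/
theorem size_le_length (φ : LTL AP) : φ.size ≤ φ.length := by
  have h1 : ∀ (a : LTL AP) (s : Set (LTL AP)), (insert a s).ncard ≤ s.ncard + 1 :=
    fun a s => Set.ncard_insert_le a s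
  have h2 : ∀ (a : LTL AP) (s t : Set (LTL AP)),
      (insert a (s ∪ t)).ncard ≤ s.ncard + t.ncard + 1 := fun a s t =>
    (h1 a _).trans (Nat.add_le_add_right (Set.ncard_union_le s t) 1)
  induction φ with
  | tt => simp [size, subformulas, length]
  | ff => simp [size, subformulas, length]
  | atom a => simp [size, subformulas, length]
  | neg φ ih => exact (h1 _ _).trans (Nat.add_le_add_right ih 1)
  | next φ ih => exact (h1 _ _).trans (Nat.add_le_add_right ih 1)
  | finally_ φ ih => exact (h1 _ _).trans (Nat.add_le_add_right ih 1)
  | globally φ ih => exact (h1 _ _).trans (Nat.add_le_add_right ih 1)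
  | and φ ψ ih ih' => exact (h2 _ _ _).trans (Nat.add_le_add_right (Nat.add_le_add ih ih') 1)
  | or φ ψ ih ih' => exact (h2 _ _ _).trans (Nat.add_le_add_right (Nat.add_le_add ih ih') 1)
  | until_ φ ψ ih ih' => exact (h2 _ _ _).trans (Nat.add_le_add_right (Nat.add_le_add ih ih') 1)

end LTL

/-- A deterministic parity automaton with state set `Q` and alphabet `S`. The transition function is
total, and every transition `(q, σ, step q σ)` carries a color in `{1, …, d}`. -/
structure DPA (Q S : Type*) where
  start : Q
  step : Q → S → Q
  d : ℕ
  color : Q → S → ℕ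
  one_le_color : ∀ q σ, 1 ≤ color q σ
  color_le : ∀ q σ, color q σ ≤ d

namespace DPA

variable {Q S : Type*}

/-- `ρ` is the run of `A` on the `ω`-word `w`. -/
def IsRun (A : DPA Q S) (w : ℕ → S) (ρ : ℕ → Q) : Prop :=
  ρ 0 = A.start ∧ ∀ i, ρ (i + 1) = A.step (ρ i) (w i)

/-- The colors that appear infinitely often along the run `ρ` on `w`. -/
def infColors (A : DPA Q S) (w : ℕ → S) (ρ : ℕ → Q) : Set ℕ :=
  {c | ∃ᶠ i in Filter.atTop, A.color (ρ i) (w i) = c}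

/-- A run is accepting if the minimal color that appears infinitely often is even. -/
def IsAccepting (A : DPA Q S) (w : ℕ → S) (ρ : ℕ → Q) : Prop :=
  ∃ c, IsLeast (A.infColors w ρ) c ∧ Even c

/-- The language of `A`: the `ω`-words on which `A` has an accepting run. -/
def language (A : DPA Q S) : Set (ℕ → S) :=
  {w | ∃ ρ, A.IsRun w ρ ∧ A.IsAccepting w ρ}

end DPA

/-! Put the formula in negation normal form and let `cl` be the set of its m subformulas. The letter
and the truth values of `cl` at the next position determine those at the current one, but this
backward recursion has many solutions: until needs a least fixpoint, release a greatest one. To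
resolve this, guess the set X of formulas that hold infinitely often and the set Y of those that
hold from some point on. Relative to X, truth on a late suffix becomes a safety property (untils
outside X are false, all fixpoints are greatest); relative to Y, it becomes a co-safety property
(releases in Y are true, all fixpoints are least).

The two guesses confirm each other: formulas of X must be co-safe infinitely often, and formulas of
Y must eventually always be safe. `sound_of_confirmed` shows that this is not circular, and
`holds_iff_exists_confirmed` turns the formula into a Boolean combination of "infinitely often"
conditions on backward iterates.

The backward maps act on the 2^m subsets of `cl`. A forward device follows them by storing a set of
such subsets, which takes doubly exponentially many states (`Window.frequently_iff`). Only 2^O(m)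
devices are needed. Running them in parallel, together with the order in which they last fired,
gives a parity condition (`LastSeen.mem_language_dpa`) and keeps the bound doubly exponential. -/

/-! ### Runs and renaming of deterministic automata. -/

namespace DPA

variable {Q S : Type*}

/-- The unique run of a deterministic transition function. -/
def runOf (start : Q) (step : Q → S → Q) (w : ℕ → S) : ℕ → Q
  | 0 => start
  | i + 1 => step (runOf start step w i) (w i)

theorem mem_language_iff (A : DPA Q S) (w : ℕ → S) :
    w ∈ A.language ↔ A.IsAccepting w (runOf A.start A.step w) := by
  constructor
  · rintro ⟨ρ, ⟨h0, hs⟩, hacc⟩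
    have : ρ = runOf A.start A.step w := by
      funext i
      induction i with
      | zero => exact h0
      | succ i ih => rw [hs, ih, runOf]
    exact this ▸ hacc
  · exact fun h => ⟨_, ⟨rfl, fun _ => rfl⟩, h⟩

/-- Renaming the states of a parity automaton. -/
def congr {Q' : Type*} (e : Q ≃ Q') (A : DPA Q S) : DPA Q' S where
  start := e A.start
  step q σ := e (A.step (e.symm q) σ)
  d := A.d
  color q σ := A.color (e.symm q) σ
  one_le_color _ _ := A.one_le_color _ _
  color_le _ _ := A.color_le _ _

theorem language_congr {Q' : Type*} (e : Q ≃ Q') (A : DPA Q S) :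
    (A.congr e).language = A.language := by
  ext w
  have h : ∀ i, e.symm (runOf (A.congr e).start (A.congr e).step w i)
      = runOf A.start A.step w i := by
    intro i
    induction i with
    | zero => simp [runOf, congr]
    | succ i ih => simp only [runOf, ← ih]; simp [congr]
  have hc : ∀ i, (A.congr e).color (runOf (A.congr e).start (A.congr e).step w i) (w i)
      = A.color (runOf A.start A.step w i) (w i) := by
    intro i
    rw [← h i]
    rfl
  simp only [mem_language_iff, IsAccepting, infColors, hc]

end DPA

/-! ### Last-seen records: from sets of recurring marks to a parity condition. -/

namespace LastSeen

variable {K : Type*}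

/-- Update of the preorder "`a` was seen at least as recently as `b`" when the marks in `M` are
seen. -/
def update (R : Set (K × K)) (M : Set K) : Set (K × K) :=
  {x | x.1 ∈ M ∨ (x.2 ∉ M ∧ x ∈ R)}

/-- The marks that were seen at least as recently as some mark of `M`. -/
def above (R : Set (K × K)) (M : Set K) : Set K := {b | ∃ a ∈ M, (b, a) ∈ R}

/-- The last-seen preorder before time `i`, when the marks `M j` are seen at time `j`. -/
def order (M : ℕ → Set K) : ℕ → Set (K × K)
  | 0 => Set.univ
  | i + 1 => update (order M i) (M i)

theorem mem_order_iff (M : ℕ → Set K) (i : ℕ) (a b : K) :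
    (a, b) ∈ order M i ↔ ∀ j < i, b ∈ M j → ∃ j', j ≤ j' ∧ j' < i ∧ a ∈ M j' := by
  induction i with
  | zero => simp [order]
  | succ i ih =>
    simp only [order, update, Set.mem_ofPred_eq, ih]
    constructor
    · rintro (h | ⟨hb, h⟩) j hj hbj
      · exact ⟨i, by omega, by omega, h⟩
      · have : j ≠ i := by rintro rfl; exact hb hbj
        obtain ⟨j', h1, h2, h3⟩ := h j (by omega) hbj
        exact ⟨j', h1, by omega, h3⟩
    · intro h
      by_cases ha : a ∈ M i
      · exact Or.inl ha
      · refine Or.inr ⟨fun hb => ?_, fun j hj hbj => ?_⟩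
        · obtain ⟨j', h1, h2, h3⟩ := h i (by omega) hb
          exact ha ((show j' = i by omega) ▸ h3)
        · obtain ⟨j', h1, h2, h3⟩ := h j (by omega) hbj
          have : j' ≠ i := by rintro rfl; exact ha h3
          exact ⟨j', h1, by omega, h3⟩

/-- The marks that are seen infinitely often. -/
def infMarks (M : ℕ → Set K) : Set K := {k | ∃ᶠ i in Filter.atTop, k ∈ M i}

/-- Let N be a time after which only recurring marks appear. Once every recurring mark has appeared
since N, whatever was seen at least as recently as one of them was also seen since N, hence recurs.
-/
theorem eventually_above_subset [Finite K] (M : ℕ → Set K) :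
    ∀ᶠ i in Filter.atTop, above (order M i) (M i) ⊆ infMarks M := by
  have h1 : ∀ᶠ i in Filter.atTop, ∀ k, k ∉ infMarks M → k ∉ M i := by
    rw [Filter.eventually_all]
    intro k
    by_cases hk : k ∈ infMarks M
    · exact Filter.Eventually.of_forall fun _ h => absurd hk h
    · exact (Filter.not_frequently.1 hk).mono fun _ h _ => h
  obtain ⟨N, hN⟩ := Filter.eventually_atTop.1 h1
  have h2 : ∀ᶠ i in Filter.atTop, ∀ k, k ∈ infMarks M → ∃ j, N ≤ j ∧ j < i ∧ k ∈ M j := by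
    rw [Filter.eventually_all]
    intro k
    by_cases hk : k ∈ infMarks M
    · obtain ⟨j, hj, hkj⟩ := Filter.frequently_atTop.1 hk N
      filter_upwards [Filter.eventually_gt_atTop j] with i hi _
      exact ⟨j, hj, hi, hkj⟩
    · exact Filter.Eventually.of_forall fun _ h => absurd h hk
  filter_upwards [h2, Filter.eventually_ge_atTop N] with i hi hNi b hb
  obtain ⟨a, ha, hba⟩ := hb
  by_contra hbI
  have haI : a ∈ infMarks M := by
    by_contra h
    exact hN i hNi a h ha
  obtain ⟨j, hNj, hji, haj⟩ := hi a haI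
  obtain ⟨j', h1, h2, h3⟩ := (mem_order_iff M i b a).1 hba j hji haj
  exact hN j' (by omega) b hbI h3

/-- Among the recurring marks, take the one whose first appearance from time N on is latest. When it
appears, it is the least recently seen of them, so all the others lie above it. -/
theorem frequently_subset_above [Finite K] (M : ℕ → Set K) :
    ∃ᶠ i in Filter.atTop, infMarks M ⊆ above (order M i) (M i) := by
  classical
  rw [Filter.frequently_atTop]
  intro N
  rcases (infMarks M).eq_empty_or_nonempty with he | hne
  · exact ⟨N, le_rfl, by simp [he]⟩
  have hex : ∀ k ∈ infMarks M, ∃ j, N ≤ j ∧ k ∈ M j := fun k hk =>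
    Filter.frequently_atTop.1 hk N
  -- The default 0 is never used for recurring marks, which all appear from N on.
  let t : K → ℕ := fun k => if h : ∃ j, N ≤ j ∧ k ∈ M j then Nat.find h else 0
  have ht : ∀ k ∈ infMarks M, N ≤ t k ∧ k ∈ M (t k) := by
    intro k hk
    simp only [t, dif_pos (hex k hk)]
    exact Nat.find_spec (hex k hk)
  have hmin : ∀ k ∈ infMarks M, ∀ j, N ≤ j → k ∈ M j → t k ≤ j := by
    intro k hk j hj hkj
    simp only [t, dif_pos (hex k hk)]
    exact Nat.find_min' (hex k hk) ⟨hj, hkj⟩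
  obtain ⟨a, ha, hmax⟩ := Set.exists_max_image (infMarks M) t (Set.toFinite _) hne
  refine ⟨t a, (ht a ha).1, fun b hb => ?_⟩
  rcases (hmax b hb).lt_or_eq with hlt | heq
  · refine ⟨a, (ht a ha).2, (mem_order_iff M _ b a).2 fun j hj haj => ?_⟩
    have hjN : j < N := by
      by_contra h
      have := hmin a ha j (by omega) haj
      omega
    exact ⟨t b, by have := (ht b hb).1; omega, hlt, (ht b hb).2⟩
  · exact ⟨b, heq ▸ (ht b hb).2, (mem_order_iff M _ b b).2 fun j hj hbj => ⟨j, le_rfl, hj, hbj⟩⟩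

open Classical in
/-- The color of the set `D` of marks: larger sets get smaller colors, accepting sets even ones. -/
noncomputable def color (Acc : Set (Set K)) (D : Set K) : ℕ :=
  2 * (Nat.card K - D.ncard) + if D ∈ Acc then 2 else 1

theorem even_color_iff (Acc : Set (Set K)) (D : Set K) : Even (color Acc D) ↔ D ∈ Acc := by
  unfold color
  split_ifs with h <;> simp [h, parity_simps]

/-- Each further element lowers the color by 2, which outweighs the parity offset of at most 1. -/
theorem color_le_of_subset [Finite K] (Acc : Set (Set K)) {D E : Set K} (h : D ⊆ E) :
    color Acc E ≤ color Acc D := by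
  rcases h.eq_or_ssubset with rfl | h
  · exact le_rfl
  · have h1 := Set.ncard_lt_ncard h (Set.toFinite E)
    have h2 := Set.ncard_le_card E
    unfold color
    split_ifs <;> omega

/-- The deterministic parity automaton for a deterministic automaton with marks on its states,
whose acceptance depends on the set of marks that are seen infinitely often. -/
noncomputable def dpa {Q S : Type*} (start : Q) (step : Q → S → Q) (mark : Q → Set K)
    (Acc : Set (Set K)) : DPA (Q × Set (K × K)) S where
  start := (start, Set.univ)
  step q σ := (step q.1 σ, update q.2 (mark q.1))
  d := 2 * Nat.card K + 2
  color q _ := color Acc (above q.2 (mark q.1))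
  one_le_color q σ := by unfold color; split_ifs <;> omega
  color_le q σ := by unfold color; split_ifs <;> omega

theorem mem_language_dpa {Q S : Type*} [Finite K] (start : Q) (step : Q → S → Q)
    (mark : Q → Set K) (Acc : Set (Set K)) (w : ℕ → S) :
    w ∈ (dpa start step mark Acc).language ↔
      infMarks (fun i => mark (DPA.runOf start step w i)) ∈ Acc := by
  set M : ℕ → Set K := fun i => mark (DPA.runOf start step w i) with hM
  have hrun : ∀ i, DPA.runOf (dpa start step mark Acc).start (dpa start step mark Acc).step w i
      = (DPA.runOf start step w i, order M i) := by
    intro i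
    induction i with
    | zero => rfl
    | succ i ih => rw [DPA.runOf, ih]; rfl
  -- The set above the current marks equals the recurring set infinitely often and is eventually
  -- contained in it, so the recurring set has the least recurring color.
  have hleast : IsLeast ((dpa start step mark Acc).infColors w
      (DPA.runOf (dpa start step mark Acc).start (dpa start step mark Acc).step w))
      (color Acc (infMarks M)) := by
    have hcol : ∀ i, (dpa start step mark Acc).color (DPA.runOf (dpa start step mark Acc).start
        (dpa start step mark Acc).step w i) (w i) = color Acc (above (order M i) (M i)) := by
      intro i
      rw [hrun]
      rfl
    simp only [DPA.infColors, hcol]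
    constructor
    · refine ((frequently_subset_above M).and_eventually (eventually_above_subset M)).mono ?_
      rintro i ⟨h1, h2⟩
      rw [h1.antisymm h2]
    · intro c hc
      obtain ⟨i, rfl, hi⟩ := (Filter.Frequently.and_eventually hc (eventually_above_subset M)).exists
      exact color_le_of_subset Acc hi
  rw [DPA.mem_language_iff, DPA.IsAccepting, ← even_color_iff Acc (infMarks M)]
  constructor
  · rintro ⟨c, hc, he⟩
    exact hc.unique hleast ▸ he
  · exact fun h => ⟨_, hleast, h⟩

end LastSeen

/-! ### Forward simulation of backward-deterministic maps. -/

section Backward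

variable {V S : Type*}

/-- The composition of the backward steps `δ` along the letters `w i, …, w (i + l - 1)`. -/
def backs (δ : S → V → V) (w : ℕ → S) (i : ℕ) : ℕ → V → V
  | 0, v => v
  | l + 1, v => backs δ w i l (δ (w (i + l)) v)

/-- The definition peels off the last letter, as a forward automaton needs; the unfolding of
formulas peels off the first. -/
theorem backs_succ (δ : S → V → V) (w : ℕ → S) (i l : ℕ) (v : V) :
    backs δ w i (l + 1) v = δ (w i) (backs δ w (i + 1) l v) := by
  induction l generalizing v with
  | zero => rfl
  | succ l ih =>
    rw [backs, ih, backs, show i + 1 + l = i + (l + 1) by omega]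

/-- A deterministic device which detects that infinitely often a condition `p i`, itself updated
deterministically, holds of some `backs δ w i l v₀`. -/
structure Window (V S : Type*) where
  δ : S → V → V
  v₀ : V
  p₀ : Set V
  upd : S → Set V → Set V

namespace Window

variable (W : Window V S)

/-- The condition at time `i`. -/
def cond (w : ℕ → S) : ℕ → Set V
  | 0 => W.p₀
  | i + 1 => W.upd (w i) (cond w i)

/-- One step: the first component is the current condition, the second one the set of values for
which the condition held at a position since the last reset. -/
def step (q : Set V × Set V) (σ : S) : Set V × Set V :=
  (W.upd σ q.1, {v | (W.v₀ ∉ q.2 ∧ W.δ σ v ∈ q.2) ∨ v ∈ W.upd σ q.1})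

def run (w : ℕ → S) : ℕ → Set V × Set V := DPA.runOf (W.p₀, W.p₀) W.step w

theorem run_fst (w : ℕ → S) (i : ℕ) : (W.run w i).1 = W.cond w i := by
  induction i with
  | zero => rfl
  | succ i ih =>
    change W.upd (w i) (W.run w i).1 = _
    rw [ih]
    rfl

theorem mem_run_succ (w : ℕ → S) (i : ℕ) (v : V) : v ∈ (W.run w (i + 1)).2 ↔
    (W.v₀ ∉ (W.run w i).2 ∧ W.δ (w i) v ∈ (W.run w i).2) ∨ v ∈ W.cond w (i + 1) := by
  change _ ∨ v ∈ W.upd (w i) (W.run w i).1 ↔ _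
  rw [run_fst]
  rfl

theorem cond_subset_run (w : ℕ → S) (i : ℕ) : W.cond w i ⊆ (W.run w i).2 := by
  intro v hv
  cases i with
  | zero => exact hv
  | succ i => exact (W.mem_run_succ w i v).2 (Or.inr hv)

/-- The device fires when `v₀` enters its second component, and the next step then discards all
older positions. Each firing thus needs a witness `i` later than the preceding firing, which yields
infinitely many `i`. -/
theorem frequently_iff (w : ℕ → S) :
    (∃ᶠ j in Filter.atTop, W.v₀ ∈ (W.run w j).2) ↔
      ∃ᶠ i in Filter.atTop, ∃ l, backs W.δ w i l W.v₀ ∈ W.cond w i := by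
  constructor
  · intro h
    rw [Filter.frequently_atTop] at h ⊢
    intro N
    obtain ⟨r, hr, hrv⟩ := h N
    have key : ∀ d v, v ∈ (W.run w (r + 1 + d)).2 →
        ∃ i l, r + 1 ≤ i ∧ i + l = r + 1 + d ∧ backs W.δ w i l v ∈ W.cond w i := by
      intro d
      induction d with
      | zero =>
        intro v hv
        rcases (W.mem_run_succ w r v).1 hv with ⟨hn, _⟩ | hv
        · exact absurd hrv hn
        · exact ⟨r + 1, 0, le_rfl, rfl, hv⟩
      | succ d ih =>
        intro v hv
        rcases (W.mem_run_succ w (r + 1 + d) v).1 hv with ⟨_, hv⟩ | hv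
        · obtain ⟨i, l, h1, h2, h3⟩ := ih _ hv
          exact ⟨i, l + 1, h1, by omega, by rw [backs, h2]; exact h3⟩
        · exact ⟨r + 1 + (d + 1), 0, by omega, rfl, hv⟩
    obtain ⟨j, hj, hjv⟩ := h (r + 1)
    obtain ⟨d, rfl⟩ := Nat.exists_eq_add_of_le hj
    obtain ⟨i, l, h1, -, h3⟩ := key d _ hjv
    exact ⟨i, by omega, l, h3⟩
  · intro h hn
    obtain ⟨N, hN⟩ := Filter.eventually_atTop.1 hn
    obtain ⟨i, hi, l, hl⟩ := Filter.frequently_atTop.1 h N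
    -- Without firings from N on there are no resets, so a witness at `i` survives until it causes a
    -- firing at `i + l`.
    have key : ∀ l v, backs W.δ w i l v ∈ W.cond w i → v ∈ (W.run w (i + l)).2 := by
      intro l
      induction l with
      | zero => exact fun v hv => W.cond_subset_run w i hv
      | succ l ih =>
        exact fun v hv => (W.mem_run_succ w (i + l) v).2
          (Or.inl ⟨hN _ (by omega), ih _ hv⟩)
    exact hN _ (by omega) (key l _ hl)

end Window

/-- Any property of the set of windows that fire infinitely often is recognized by a deterministic
parity automaton. -/
theorem exists_dpa_of_windows {K : Type*} [Finite K] [Finite V] (W : K → Window V S)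
    (Acc : Set (Set K)) :
    ∃ (Q : Type) (_ : Fintype Q) (A : DPA Q S),
      (∀ w, w ∈ A.language ↔
        {k | ∃ᶠ i in Filter.atTop, ∃ l, backs (W k).δ w i l (W k).v₀ ∈ (W k).cond w i} ∈ Acc) ∧
      Fintype.card Q = 2 ^ (2 * Nat.card V * Nat.card K + Nat.card K * Nat.card K) := by
  let start : K → Set V × Set V := fun k => ((W k).p₀, (W k).p₀)
  let step : (K → Set V × Set V) → S → K → Set V × Set V := fun q σ k => (W k).step (q k) σ
  let mark : (K → Set V × Set V) → Set K := fun q => {k | (W k).v₀ ∈ (q k).2}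
  let A := LastSeen.dpa start step mark Acc
  -- Renaming the states to an initial segment of ℕ places them in `Type`, whatever the universes of
  -- `K` and `V`.
  let e := Finite.equivFin ((K → Set V × Set V) × Set (K × K))
  refine ⟨_, inferInstance, A.congr e, fun w => ?_, ?_⟩
  · have hrun : ∀ i k, DPA.runOf start step w i k = (W k).run w i := by
      intro i k
      induction i with
      | zero => rfl
      | succ i ih =>
        change (W k).step (DPA.runOf start step w i k) (w i) = _
        rw [ih]
        rfl
    rw [DPA.language_congr, LastSeen.mem_language_dpa]
    simp only [LastSeen.infMarks, mark, Set.mem_ofPred_eq, hrun, Window.frequently_iff]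
  · have hset : ∀ α : Type _, [Finite α] → Nat.card (Set α) = 2 ^ Nat.card α := by
      intro α _
      rw [← Set.ncard_univ, ← Set.powerset_univ, Set.ncard_powerset _ Set.finite_univ,
        Set.ncard_univ]
    have hset' : Nat.card (Set (K × K)) = 2 ^ (Nat.card K * Nat.card K) := by
      rw [← Set.ncard_univ, ← Set.powerset_univ, Set.ncard_powerset _ Set.finite_univ,
        Set.ncard_univ, Nat.card_prod]
    rw [Fintype.card_fin, Nat.card_prod, hset', Nat.card_fun, Nat.card_prod, hset V, ← pow_add,
      ← pow_mul, ← pow_add, two_mul]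

end Backward

/-! ### Negation normal form and the expansion laws. -/

/-- Formulas of linear temporal logic in negation normal form. -/
inductive PNF (AP : Type*) where
  | const (b : Bool) : PNF AP
  | lit (a : AP) (b : Bool) : PNF AP
  | and (φ ψ : PNF AP) : PNF AP
  | or (φ ψ : PNF AP) : PNF AP
  | next (φ : PNF AP) : PNF AP
  | until_ (φ ψ : PNF AP) : PNF AP
  | release (φ ψ : PNF AP) : PNF AP

namespace PNF

variable {AP : Type*}

/-- Satisfaction at position `i` of an `ω`-word. -/
def Holds (w : ℕ → Set AP) : PNF AP → ℕ → Prop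
  | const b, _ => b = true
  | lit a b, i => a ∈ w i ↔ b = true
  | and φ ψ, i => Holds w φ i ∧ Holds w ψ i
  | or φ ψ, i => Holds w φ i ∨ Holds w ψ i
  | next φ, i => Holds w φ (i + 1)
  | until_ φ ψ, i => ∃ k, Holds w ψ (i + k) ∧ ∀ j < k, Holds w φ (i + j)
  | release φ ψ, i => ∀ k, Holds w ψ (i + k) ∨ ∃ j < k, Holds w φ (i + j)

theorem holds_until (w : ℕ → Set AP) (φ ψ : PNF AP) (i : ℕ) :
    Holds w (until_ φ ψ) i ↔ Holds w ψ i ∨ (Holds w φ i ∧ Holds w (until_ φ ψ) (i + 1)) := by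
  constructor
  · rintro ⟨k, hk, hj⟩
    cases k with
    | zero => exact Or.inl hk
    | succ k =>
      refine Or.inr ⟨hj 0 (by omega), k, ?_, fun j h => ?_⟩
      · rwa [show i + 1 + k = i + (k + 1) by omega]
      · rw [show i + 1 + j = i + (j + 1) by omega]
        exact hj _ (by omega)
  · rintro (h | ⟨h, k, hk, hj⟩)
    · exact ⟨0, h, fun _ h => absurd h (by omega)⟩
    · refine ⟨k + 1, ?_, fun j hjk => ?_⟩
      · rwa [show i + (k + 1) = i + 1 + k by omega]
      · cases j with
        | zero => exact h
        | succ j =>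
          rw [show i + (j + 1) = i + 1 + j by omega]
          exact hj _ (by omega)

theorem holds_release (w : ℕ → Set AP) (φ ψ : PNF AP) (i : ℕ) :
    Holds w (release φ ψ) i ↔ Holds w ψ i ∧ (Holds w φ i ∨ Holds w (release φ ψ) (i + 1)) := by
  constructor
  · intro h
    refine ⟨(h 0).resolve_right (by simp), ?_⟩
    by_cases hφ : Holds w φ i
    · exact Or.inl hφ
    refine Or.inr fun k => ?_
    rcases h (k + 1) with hk | ⟨j, hj, hk⟩
    · exact Or.inl (by rwa [show i + 1 + k = i + (k + 1) by omega])
    · cases j with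
      | zero => exact absurd hk hφ
      | succ j => exact Or.inr ⟨j, by omega, by rwa [show i + 1 + j = i + (j + 1) by omega]⟩
  · rintro ⟨h, h'⟩ k
    cases k with
    | zero => exact Or.inl h
    | succ k =>
      rcases h' with h' | h'
      · exact Or.inr ⟨0, by omega, h'⟩
      · rcases h' k with hk | ⟨j, hj, hk⟩
        · exact Or.inl (by rwa [show i + (k + 1) = i + 1 + k by omega])
        · exact Or.inr ⟨j + 1, by omega, by rwa [show i + (j + 1) = i + 1 + j by omega]⟩

/-! ### One-step unfolding and its least and greatest solutions. -/

/-- One-step unfolding: `val X Y σ S φ` says that `φ` holds at a position with letter `σ` if exactly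
the formulas in `S` hold at the next position, where until-formulas outside `X` are taken to be
false and release-formulas in `Y` are taken to be true. -/
def val (X Y : Set (PNF AP)) (σ : Set AP) (S : Set (PNF AP)) : PNF AP → Prop
  | const b => b = true
  | lit a b => a ∈ σ ↔ b = true
  | and φ ψ => val X Y σ S φ ∧ val X Y σ S ψ
  | or φ ψ => val X Y σ S φ ∨ val X Y σ S ψ
  | next φ => φ ∈ S
  | until_ φ ψ => until_ φ ψ ∈ X ∧ (val X Y σ S ψ ∨ (val X Y σ S φ ∧ until_ φ ψ ∈ S))
  | release φ ψ => release φ ψ ∈ Y ∨ (val X Y σ S ψ ∧ (val X Y σ S φ ∨ release φ ψ ∈ S))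

theorem val_mono {X X' Y Y' S S' : Set (PNF AP)} (hX : X ⊆ X') (hY : Y ⊆ Y') (hS : S ⊆ S')
    (σ : Set AP) (φ : PNF AP) (h : val X Y σ S φ) : val X' Y' σ S' φ := by
  induction φ with
  | const b => exact h
  | lit a b => exact h
  | and φ ψ h1 h2 => exact ⟨h1 h.1, h2 h.2⟩
  | or φ ψ h1 h2 => exact h.imp h1 h2
  | next φ _ => exact hS h
  | until_ φ ψ h1 h2 => exact ⟨hX h.1, h.2.imp h2 fun h => ⟨h1 h.1, hS h.2⟩⟩
  | release φ ψ h1 h2 => exact h.imp (fun h => hY h) fun h => ⟨h2 h.1, h.2.imp h1 fun h => hS h⟩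

/-- `val` commutes with unions of increasing sequences. -/
theorem val_iUnion {X Y : Set (PNF AP)} {S : ℕ → Set (PNF AP)} (hS : Monotone S) (σ : Set AP)
    (φ : PNF AP) (h : val X Y σ (⋃ l, S l) φ) : ∃ l, val X Y σ (S l) φ := by
  have mono : ∀ {l l'} (φ : PNF AP), l ≤ l' → val X Y σ (S l) φ → val X Y σ (S l') φ :=
    fun φ h => val_mono le_rfl le_rfl (hS h) σ φ
  induction φ with
  | const b => exact ⟨0, h⟩
  | lit a b => exact ⟨0, h⟩
  | and φ ψ h1 h2 =>
    obtain ⟨l, hl⟩ := h1 h.1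
    obtain ⟨l', hl'⟩ := h2 h.2
    exact ⟨max l l', mono _ (le_max_left _ _) hl, mono _ (le_max_right _ _) hl'⟩
  | or φ ψ h1 h2 =>
    rcases h with h | h
    · exact (h1 h).imp fun _ => Or.inl
    · exact (h2 h).imp fun _ => Or.inr
  | next φ _ => exact Set.mem_iUnion.1 h
  | until_ φ ψ h1 h2 =>
    obtain ⟨hX, h | ⟨h, h'⟩⟩ := h
    · exact (h2 h).imp fun _ h => ⟨hX, Or.inl h⟩
    · obtain ⟨l, hl⟩ := h1 h
      obtain ⟨l', hl'⟩ := Set.mem_iUnion.1 h'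
      exact ⟨max l l', hX, Or.inr ⟨mono _ (le_max_left _ _) hl, hS (le_max_right _ _) hl'⟩⟩
  | release φ ψ h1 h2 =>
    rcases h with h | ⟨h, h' | h'⟩
    · exact ⟨0, Or.inl h⟩
    · obtain ⟨l, hl⟩ := h2 h
      obtain ⟨l', hl'⟩ := h1 h'
      exact ⟨max l l', Or.inr ⟨mono _ (le_max_left _ _) hl,
        Or.inl (mono _ (le_max_right _ _) hl')⟩⟩
    · obtain ⟨l, hl⟩ := h2 h
      obtain ⟨l', hl'⟩ := Set.mem_iUnion.1 h'
      exact ⟨max l l', Or.inr ⟨mono _ (le_max_left _ _) hl, Or.inr (hS (le_max_right _ _) hl')⟩⟩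

/-- `val` commutes with intersections of decreasing sequences. -/
theorem val_iInter {X Y : Set (PNF AP)} {S : ℕ → Set (PNF AP)} (hS : Antitone S) (σ : Set AP)
    (φ : PNF AP) (h : ∀ l, val X Y σ (S l) φ) : val X Y σ (⋂ l, S l) φ := by
  have mono : ∀ {l l'} (φ : PNF AP), l ≤ l' → val X Y σ (S l') φ → val X Y σ (S l) φ :=
    fun φ h => val_mono le_rfl le_rfl (hS h) σ φ
  -- Failures of `p` and of `q` persist, so both would fail at the larger of the two indices.
  have split : ∀ {p q : ℕ → Prop}, (∀ {l l'}, l ≤ l' → p l' → p l) →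
      (∀ {l l'}, l ≤ l' → q l' → q l) → (∀ l, p l ∨ q l) → (∀ l, p l) ∨ ∀ l, q l := by
    intro p q hp hq h
    by_contra! hn
    obtain ⟨⟨a, ha⟩, b, hb⟩ := hn
    rcases h (max a b) with h | h
    · exact ha (hp (le_max_left _ _) h)
    · exact hb (hq (le_max_right _ _) h)
  induction φ with
  | const b => exact h 0
  | lit a b => exact h 0
  | and φ ψ h1 h2 => exact ⟨h1 fun l => (h l).1, h2 fun l => (h l).2⟩
  | or φ ψ h1 h2 => exact (split (mono φ) (mono ψ) h).imp h1 h2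
  | next φ _ => exact Set.mem_iInter.2 h
  | until_ φ ψ h1 h2 =>
    refine ⟨(h 0).1, (split (mono ψ) ?_ fun l => (h l).2).imp h2 fun h =>
      ⟨h1 fun l => (h l).1, Set.mem_iInter.2 fun l => (h l).2⟩⟩
    exact fun hl h => ⟨mono φ hl h.1, hS hl h.2⟩
  | release φ ψ h1 h2 =>
    by_cases hY : release φ ψ ∈ Y
    · exact Or.inl hY
    have h' := fun l => (h l).resolve_left hY
    refine Or.inr ⟨h2 fun l => (h' l).1, (split (mono φ) ?_ fun l => (h' l).2).imp h1 fun h =>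
      Set.mem_iInter.2 h⟩
    exact fun hl h => hS hl h

/-- The formulas of `cl` that hold at a position with letter `σ` according to `val`. -/
def back (cl X Y : Set (PNF AP)) (σ : Set AP) (S : Set (PNF AP)) : Set (PNF AP) :=
  {φ ∈ cl | val X Y σ S φ}

section Back

variable {cl X X' Y Y' S S' : Set (PNF AP)} (w : ℕ → Set AP)

theorem back_mono (hX : X ⊆ X') (hY : Y ⊆ Y') (hS : S ⊆ S') (σ : Set AP) :
    back cl X Y σ S ⊆ back cl X' Y' σ S' :=
  fun φ h => ⟨h.1, val_mono hX hY hS σ φ h.2⟩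

theorem backs_mono (hX : X ⊆ X') (hY : Y ⊆ Y') (hS : S ⊆ S') (i l : ℕ) :
    backs (back cl X Y) w i l S ⊆ backs (back cl X' Y') w i l S' := by
  induction l generalizing S S' with
  | zero => exact hS
  | succ l ih => exact ih (back_mono hX hY hS _)

theorem mem_backs_succ (i l : ℕ) (φ : PNF AP) : φ ∈ backs (back cl X Y) w i (l + 1) S ↔
    φ ∈ cl ∧ val X Y (w i) (backs (back cl X Y) w (i + 1) l S) φ := by
  rw [backs_succ]
  rfl

theorem backs_cl_antitone (i : ℕ) : Antitone fun l => backs (back cl X Y) w i l cl :=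
  antitone_nat_of_succ_le fun l => backs_mono w le_rfl le_rfl (fun _ h => h.1) i l

theorem backs_empty_monotone (i : ℕ) : Monotone fun l => backs (back cl X Y) w i l ∅ :=
  monotone_nat_of_le_succ fun l => backs_mono w le_rfl le_rfl (Set.empty_subset _) i l

/-- `backs` commutes with intersections of decreasing sequences. -/
theorem mem_backs_iInter {S : ℕ → Set (PNF AP)} (hS : Antitone S) (i l : ℕ) (φ : PNF AP)
    (h : ∀ m, φ ∈ backs (back cl X Y) w i l (S m)) :
    φ ∈ backs (back cl X Y) w i l (⋂ m, S m) := by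
  induction l generalizing S with
  | zero => exact Set.mem_iInter.2 h
  | succ l ih =>
    refine backs_mono w le_rfl le_rfl ?_ i l (ih
      (S := fun m => back cl X Y (w (i + l)) (S m))
      (fun a b hab => back_mono le_rfl le_rfl (hS hab) _) h)
    intro ψ hψ
    rw [Set.mem_iInter] at hψ
    exact ⟨(hψ 0).1, val_iInter hS _ ψ fun m => (hψ m).2⟩

/-- The formulas that hold at position `i` when all fixpoints are greatest fixpoints. -/
def safe (cl X Y : Set (PNF AP)) (w : ℕ → Set AP) (i : ℕ) : Set (PNF AP) :=
  ⋂ l, backs (back cl X Y) w i l cl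

/-- The formulas that hold at position `i` when all fixpoints are least fixpoints. -/
def cosafe (cl X Y : Set (PNF AP)) (w : ℕ → Set AP) (i : ℕ) : Set (PNF AP) :=
  ⋃ l, backs (back cl X Y) w i l ∅

/-- A sequence of sets of formulas that is compatible with the one-step unfolding. -/
def Consistent (cl X Y : Set (PNF AP)) (w : ℕ → Set AP) (S : ℕ → Set (PNF AP)) : Prop :=
  ∀ i, S i = back cl X Y (w i) (S (i + 1))

/-- A compactness argument: `val` commutes with the decreasing intersection, so the limit of the
finite iterates is a fixpoint. -/
theorem consistent_safe : Consistent cl X Y w (safe cl X Y w) := by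
  intro i
  ext φ
  constructor
  · intro h
    have h' : ∀ l, φ ∈ back cl X Y (w i) (backs (back cl X Y) w (i + 1) l cl) := fun l => by
      rw [← backs_succ (back cl X Y)]
      exact Set.mem_iInter.1 h (l + 1)
    exact ⟨(h' 0).1, val_iInter (backs_cl_antitone w _) _ φ fun l => (h' l).2⟩
  · intro h
    refine Set.mem_iInter.2 fun l => ?_
    cases l with
    | zero => exact h.1
    | succ l =>
      rw [backs_succ]
      exact back_mono le_rfl le_rfl (Set.iInter_subset _ l) _ h

theorem consistent_cosafe : Consistent cl X Y w (cosafe cl X Y w) := by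
  intro i
  ext φ
  constructor
  · intro h
    obtain ⟨l, hl⟩ := Set.mem_iUnion.1 h
    cases l with
    | zero => exact absurd hl (Set.notMem_empty _)
    | succ l =>
      rw [backs_succ] at hl
      exact back_mono le_rfl le_rfl (Set.subset_iUnion
        (fun l => backs (back cl X Y) w (i + 1) l ∅) l) _ hl
  · intro h
    obtain ⟨l, hl⟩ := val_iUnion (backs_empty_monotone w _) _ φ h.2
    exact Set.mem_iUnion.2 ⟨l + 1, (mem_backs_succ w i l φ).2 ⟨h.1, hl⟩⟩

theorem Consistent.mem_iff {w : ℕ → Set AP} {S : ℕ → Set (PNF AP)} (h : Consistent cl X Y w S)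
    (i : ℕ) (φ : PNF AP) : φ ∈ S i ↔ φ ∈ cl ∧ val X Y (w i) (S (i + 1)) φ := by
  rw [h i]
  rfl

end Back

/-! ### Comparison of truth with the safe and co-safe approximations. -/

/-- Closure under direct subformulas. -/
structure Closed (cl : Set (PNF AP)) : Prop where
  and : ∀ φ ψ, and φ ψ ∈ cl → φ ∈ cl ∧ ψ ∈ cl
  or : ∀ φ ψ, or φ ψ ∈ cl → φ ∈ cl ∧ ψ ∈ cl
  next : ∀ φ, next φ ∈ cl → φ ∈ cl
  until_ : ∀ φ ψ, until_ φ ψ ∈ cl → φ ∈ cl ∧ ψ ∈ cl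
  release : ∀ φ ψ, release φ ψ ∈ cl → φ ∈ cl ∧ ψ ∈ cl

variable {cl X Y : Set (PNF AP)} {w : ℕ → Set AP}

/-- The formulas of `cl` that hold at position `i`. -/
def truth (cl : Set (PNF AP)) (w : ℕ → Set AP) (i : ℕ) : Set (PNF AP) := {φ ∈ cl | Holds w φ i}

theorem val_truth_iff (hcl : Closed cl) (i : ℕ) (φ : PNF AP) (hφ : φ ∈ cl) :
    val cl ∅ (w i) (truth cl w (i + 1)) φ ↔ Holds w φ i := by
  induction φ with
  | const b => rfl
  | lit a b => rfl
  | and φ ψ h1 h2 => exact and_congr (h1 (hcl.and _ _ hφ).1) (h2 (hcl.and _ _ hφ).2)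
  | or φ ψ h1 h2 => exact or_congr (h1 (hcl.or _ _ hφ).1) (h2 (hcl.or _ _ hφ).2)
  | next φ _ => exact and_iff_right (hcl.next _ hφ)
  | until_ φ ψ h1 h2 =>
    rw [holds_until, val, h1 (hcl.until_ _ _ hφ).1, h2 (hcl.until_ _ _ hφ).2]
    simp [truth, hφ]
  | release φ ψ h1 h2 =>
    rw [holds_release, val, h1 (hcl.release _ _ hφ).1, h2 (hcl.release _ _ hφ).2]
    simp [truth, hφ]

theorem consistent_truth (hcl : Closed cl) : Consistent cl cl ∅ w (truth cl w) := by
  intro i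
  ext φ
  exact and_congr_right fun h => (val_truth_iff hcl i φ h).symm

theorem Consistent.eq_backs {S : ℕ → Set (PNF AP)} (h : Consistent cl X Y w S) (i l : ℕ) :
    S i = backs (back cl X Y) w i l (S (i + l)) := by
  induction l with
  | zero => rfl
  | succ l ih => rw [backs, ← add_assoc, ← h (i + l), ← ih]

/-- If all until-formulas that hold from position `N` on are in `X`, then formulas that hold are
safe. -/
theorem truth_subset_safe (hcl : Closed cl) {N : ℕ}
    (hX : ∀ i ≥ N, ∀ φ ∈ cl, Holds w φ i → φ ∈ X) {i : ℕ} (hi : N ≤ i) :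
    truth cl w i ⊆ safe cl X ∅ w i := by
  have key : ∀ i ≥ N, ∀ φ ∈ cl, val cl ∅ (w i) (truth cl w (i + 1)) φ →
      val X ∅ (w i) (truth cl w (i + 1)) φ := by
    intro i hi φ hφ h
    induction φ with
    | const b => exact h
    | lit a b => exact h
    | and φ ψ h1 h2 => exact ⟨h1 (hcl.and _ _ hφ).1 h.1, h2 (hcl.and _ _ hφ).2 h.2⟩
    | or φ ψ h1 h2 => exact h.imp (h1 (hcl.or _ _ hφ).1) (h2 (hcl.or _ _ hφ).2)
    | next φ _ => exact h
    | until_ φ ψ h1 h2 =>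
      exact ⟨hX i hi _ hφ ((val_truth_iff hcl i _ hφ).1 h), h.2.imp (h2 (hcl.until_ _ _ hφ).2)
        fun h => ⟨h1 (hcl.until_ _ _ hφ).1 h.1, h.2⟩⟩
    | release φ ψ h1 h2 =>
      exact h.imp id fun h => ⟨h2 (hcl.release _ _ hφ).2 h.1,
        h.2.imp (h1 (hcl.release _ _ hφ).1) id⟩
  intro φ hφ
  refine Set.mem_iInter.2 fun l => ?_
  induction l generalizing i φ with
  | zero => exact hφ.1
  | succ l ih =>
    refine (mem_backs_succ w i l φ).2 ⟨hφ.1, val_mono le_rfl le_rfl (fun ψ hψ => ih (by omega) hψ)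
      _ _ (key i hi φ hφ.1 ((val_truth_iff hcl i φ hφ.1).2 hφ.2))⟩

/-- If all release-formulas that eventually always hold are in `Y`, then formulas that hold are
co-safe. -/
theorem truth_subset_cosafe (hcl : Closed cl)
    (hY : ∀ φ ∈ cl, (∃ N, ∀ i ≥ N, Holds w φ i) → φ ∈ Y) (i : ℕ) :
    truth cl w i ⊆ cosafe cl cl Y w i := by
  rintro φ ⟨hφ, h⟩
  have C := consistent_cosafe (cl := cl) (X := cl) (Y := Y) w
  induction φ generalizing i with
  | const b => exact (C.mem_iff i _).2 ⟨hφ, h⟩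
  | lit a b => exact (C.mem_iff i _).2 ⟨hφ, h⟩
  | and φ ψ h1 h2 =>
    exact (C.mem_iff i _).2 ⟨hφ, ((C.mem_iff i _).1 (h1 i (hcl.and _ _ hφ).1 h.1)).2,
      ((C.mem_iff i _).1 (h2 i (hcl.and _ _ hφ).2 h.2)).2⟩
  | or φ ψ h1 h2 =>
    exact (C.mem_iff i _).2 ⟨hφ, h.imp
      (fun h => ((C.mem_iff i _).1 (h1 i (hcl.or _ _ hφ).1 h)).2)
      (fun h => ((C.mem_iff i _).1 (h2 i (hcl.or _ _ hφ).2 h)).2)⟩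
  | next φ h1 => exact (C.mem_iff i _).2 ⟨hφ, h1 _ (hcl.next _ hφ) h⟩
  | until_ φ ψ h1 h2 =>
    obtain ⟨k, hk⟩ := h
    induction k generalizing i with
    | zero =>
      exact (C.mem_iff i _).2 ⟨hφ, hφ, Or.inl
        ((C.mem_iff i _).1 (h2 i (hcl.until_ _ _ hφ).2 hk.1)).2⟩
    | succ k ih =>
      refine (C.mem_iff i _).2 ⟨hφ, hφ, Or.inr
        ⟨((C.mem_iff i _).1 (h1 i (hcl.until_ _ _ hφ).1 (hk.2 0 (by omega)))).2,
          ih (i + 1) ⟨?_, fun j hj => ?_⟩⟩⟩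
      · rw [show i + 1 + k = i + (k + 1) by omega]
        exact hk.1
      · rw [show i + 1 + j = i + (j + 1) by omega]
        exact hk.2 _ (by omega)
  | release φ ψ h1 h2 =>
    by_cases hr : release φ ψ ∈ Y
    · exact (C.mem_iff i _).2 ⟨hφ, Or.inl hr⟩
    -- A release outside `Y` fails at some later position, so only finitely many unfoldings are
    -- needed; the induction is on the distance to that failure.
    have hn : ∃ k, ¬ Holds w (release φ ψ) (i + k) := by
      by_contra! hn
      refine hr (hY _ hφ ⟨i, fun j hj => ?_⟩)
      obtain ⟨k, rfl⟩ := Nat.exists_eq_add_of_le hj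
      exact hn k
    obtain ⟨k, hk⟩ := hn
    induction k generalizing i with
    | zero => exact absurd h hk
    | succ k ih =>
      obtain ⟨hψ, h⟩ := (holds_release w φ ψ i).1 h
      refine (C.mem_iff i _).2 ⟨hφ, Or.inr
        ⟨((C.mem_iff i _).1 (h2 i (hcl.release _ _ hφ).2 hψ)).2, h.imp (fun h =>
          ((C.mem_iff i _).1 (h1 i (hcl.release _ _ hφ).1 h)).2) fun h => ih (i + 1) h ?_⟩⟩
      rwa [show i + 1 + k = i + (k + 1) by omega]

/-! ### Mutual confirmation of the two guesses. -/

/-- The guesses `X` and `Y` are confirmed by `w`: every formula of `X` is infinitely often co-safe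
relative to `Y`, and every formula of `Y` is eventually always safe relative to `X`. -/
def Confirmed (cl X Y : Set (PNF AP)) (w : ℕ → Set AP) : Prop :=
  (∀ φ ∈ X, ∃ᶠ i in Filter.atTop, φ ∈ cosafe cl cl Y w i) ∧
    ∀ φ ∈ Y, ∀ᶠ i in Filter.atTop, φ ∈ safe cl X ∅ w i

/-- Soundness of safety and of eventual co-safety are proved in one structural induction, which
breaks the circularity: for until, co-safe soundness comes first and is used for safe soundness; for
release the order is reversed. -/
theorem sound_of_confirmed (hcl : Closed cl) (hXY : Confirmed cl X Y w) (φ : PNF AP)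
    (hφ : φ ∈ cl) :
    (∀ i, φ ∈ safe cl X ∅ w i → Holds w φ i) ∧
      ∀ᶠ i in Filter.atTop, ∀ l, φ ∈ backs (back cl cl Y) w i l ∅ → Holds w φ i := by
  have C := consistent_safe (cl := cl) (X := X) (Y := ∅) w
  have sub : ∀ {i φ}, φ ∈ cl → val X ∅ (w i) (safe cl X ∅ w (i + 1)) φ → φ ∈ safe cl X ∅ w i :=
    fun hφ h => (C.mem_iff _ _).2 ⟨hφ, h⟩
  have subc : ∀ {i l φ}, φ ∈ cl → val cl Y (w i) (backs (back cl cl Y) w (i + 1) l ∅) φ →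
      φ ∈ backs (back cl cl Y) w i (l + 1) ∅ := fun hφ h => (mem_backs_succ w _ _ _).2 ⟨hφ, h⟩
  induction φ with
  | const b =>
    refine ⟨fun i h => ((C.mem_iff i _).1 h).2, Filter.Eventually.of_forall fun i l h => ?_⟩
    cases l with
    | zero => exact absurd h (Set.notMem_empty _)
    | succ l => exact ((mem_backs_succ w i l _).1 h).2
  | lit a b =>
    refine ⟨fun i h => ((C.mem_iff i _).1 h).2, Filter.Eventually.of_forall fun i l h => ?_⟩
    cases l with
    | zero => exact absurd h (Set.notMem_empty _)
    | succ l => exact ((mem_backs_succ w i l _).1 h).2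
  | and φ ψ h1 h2 =>
    obtain ⟨c1, c2⟩ := hcl.and _ _ hφ
    refine ⟨fun i h => ?_, ?_⟩
    · have := ((C.mem_iff i _).1 h).2
      exact ⟨(h1 c1).1 i (sub c1 this.1), (h2 c2).1 i (sub c2 this.2)⟩
    · filter_upwards [(h1 c1).2, (h2 c2).2] with i e1 e2 l h
      cases l with
      | zero => exact absurd h (Set.notMem_empty _)
      | succ l =>
        have := ((mem_backs_succ w i l _).1 h).2
        exact ⟨e1 _ (subc c1 this.1), e2 _ (subc c2 this.2)⟩
  | or φ ψ h1 h2 =>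
    obtain ⟨c1, c2⟩ := hcl.or _ _ hφ
    refine ⟨fun i h => ?_, ?_⟩
    · exact ((C.mem_iff i _).1 h).2.imp (fun h => (h1 c1).1 i (sub c1 h))
        fun h => (h2 c2).1 i (sub c2 h)
    · filter_upwards [(h1 c1).2, (h2 c2).2] with i e1 e2 l h
      cases l with
      | zero => exact absurd h (Set.notMem_empty _)
      | succ l =>
        exact ((mem_backs_succ w i l _).1 h).2.imp (fun h => e1 _ (subc c1 h))
          fun h => e2 _ (subc c2 h)
  | next φ h1 =>
    have c1 := hcl.next _ hφ
    refine ⟨fun i h => (h1 c1).1 _ ((C.mem_iff i _).1 h).2, ?_⟩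
    filter_upwards [(Filter.tendsto_add_atTop_nat 1).eventually (h1 c1).2] with i e1 l h
    cases l with
    | zero => exact absurd h (Set.notMem_empty _)
    | succ l => exact e1 l ((mem_backs_succ w i l _).1 h).2
  | until_ φ ψ h1 h2 =>
    obtain ⟨c1, c2⟩ := hcl.until_ _ _ hφ
    have hco : ∀ᶠ i in Filter.atTop, ∀ l, until_ φ ψ ∈ backs (back cl cl Y) w i l ∅ →
        Holds w (until_ φ ψ) i := by
      obtain ⟨N, hN⟩ := Filter.eventually_atTop.1 ((h1 c1).2.and (h2 c2).2)
      refine Filter.eventually_atTop.2 ⟨N, fun i hi l h => ?_⟩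
      induction l generalizing i with
      | zero => exact absurd h (Set.notMem_empty _)
      | succ l ih =>
        rw [holds_until]
        exact ((mem_backs_succ w i l _).1 h).2.2.imp (fun h => (hN i hi).2 _ (subc c2 h))
          fun h => ⟨(hN i hi).1 _ (subc c1 h.1), ih _ (by omega) h.2⟩
    refine ⟨fun i h => ?_, hco⟩
    -- Membership in `X` makes the until co-safe, hence true, at some later `k`; this truth is then
    -- pulled back to `i` along the safe unfolding.
    have hX : until_ φ ψ ∈ X := ((C.mem_iff i _).1 h).2.1
    obtain ⟨k, hk, hik⟩ : ∃ k ≥ i, Holds w (until_ φ ψ) k := by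
      obtain ⟨k, ⟨hk, hke⟩, hik⟩ := (((hXY.1 _ hX).and_eventually hco).and_eventually
        (Filter.eventually_ge_atTop i)).exists
      obtain ⟨l, hl⟩ := Set.mem_iUnion.1 hk
      exact ⟨k, hik, hke l hl⟩
    obtain ⟨d, rfl⟩ := Nat.exists_eq_add_of_le hk
    induction d generalizing i with
    | zero => exact hik
    | succ d ih =>
      rw [holds_until]
      refine ((C.mem_iff i _).1 h).2.2.imp (fun h => (h2 c2).1 i (sub c2 h))
          fun h => ⟨(h1 c1).1 i (sub c1 h.1), ih _ h.2 (by omega) ?_⟩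
      rwa [show i + 1 + d = i + (d + 1) by omega]
  | release φ ψ h1 h2 =>
    obtain ⟨c1, c2⟩ := hcl.release _ _ hφ
    have hsafe : ∀ i, release φ ψ ∈ safe cl X ∅ w i → Holds w (release φ ψ) i := by
      intro i h k
      induction k generalizing i with
      | zero =>
        have := ((C.mem_iff i _).1 h).2.resolve_left (Set.notMem_empty _)
        exact Or.inl ((h2 c2).1 i (sub c2 this.1))
      | succ k ih =>
        have := ((C.mem_iff i _).1 h).2.resolve_left (Set.notMem_empty _)
        rcases this.2 with h | h
        · exact Or.inr ⟨0, by omega, (h1 c1).1 i (sub c1 h)⟩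
        · refine (ih (i + 1) h).imp (fun h => ?_) ?_
          · rwa [show i + (k + 1) = i + 1 + k by omega]
          · rintro ⟨j, hj, h⟩
            exact ⟨j + 1, by omega, by rwa [show i + (j + 1) = i + 1 + j by omega]⟩
    refine ⟨hsafe, ?_⟩
    by_cases hY : release φ ψ ∈ Y
    · filter_upwards [hXY.2 _ hY] with i hi l _
      exact hsafe i hi
    obtain ⟨N, hN⟩ := Filter.eventually_atTop.1 ((h1 c1).2.and (h2 c2).2)
    refine Filter.eventually_atTop.2 ⟨N, fun i hi l h => ?_⟩
    induction l generalizing i with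
    | zero => exact absurd h (Set.notMem_empty _)
    | succ l ih =>
      have := ((mem_backs_succ w i l _).1 h).2.resolve_left hY
      rw [holds_release]
      exact ⟨(hN i hi).2 _ (subc c2 this.1), this.2.imp (fun h => (hN i hi).1 _ (subc c1 h))
        fun h => ih _ (by omega) h⟩

/-- A formula holds iff, for some confirmed guesses, its unfolding is eventually safe. -/
theorem holds_iff_exists_confirmed (hfin : cl.Finite) (hcl : Closed cl) (φ : PNF AP)
    (hφ : φ ∈ cl) : Holds w φ 0 ↔ ∃ X ⊆ cl, ∃ Y ⊆ cl, Confirmed cl X Y w ∧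
      ∀ᶠ i in Filter.atTop, ∀ l,
        φ ∈ backs (back cl cl ∅) w 0 i (backs (back cl X ∅) w i l cl) := by
  constructor
  · intro h
    -- The correct guesses are read off from the word itself.
    let X : Set (PNF AP) := {ψ ∈ cl | ∃ᶠ i in Filter.atTop, Holds w ψ i}
    let Y : Set (PNF AP) := {ψ ∈ cl | ∀ᶠ i in Filter.atTop, Holds w ψ i}
    have hX : ∀ᶠ i in Filter.atTop, ∀ ψ ∈ cl, Holds w ψ i → ψ ∈ X := by
      rw [Filter.eventually_all_finite hfin]
      intro ψ hψ
      by_cases hf : ∃ᶠ i in Filter.atTop, Holds w ψ i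
      · exact Filter.Eventually.of_forall fun _ _ => ⟨hψ, hf⟩
      · exact (Filter.not_frequently.1 hf).mono fun _ h h' => absurd h' h
    obtain ⟨N, hN⟩ := Filter.eventually_atTop.1 hX
    have hsafe := fun {i} (hi : N ≤ i) => truth_subset_safe hcl hN hi
    refine ⟨X, fun _ h => h.1, Y, fun _ h => h.1, ⟨fun ψ hψ => ?_, fun ψ hψ => ?_⟩, ?_⟩
    · refine hψ.2.mono fun i hi => truth_subset_cosafe hcl (fun χ hχ he => ?_) i ⟨hψ.1, hi⟩
      exact ⟨hχ, Filter.eventually_atTop.2 he⟩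
    · filter_upwards [hψ.2, Filter.eventually_ge_atTop N] with i hi hNi
      exact hsafe hNi ⟨hψ.1, hi⟩
    · filter_upwards [Filter.eventually_ge_atTop N] with i hi l
      have h0 : φ ∈ truth cl w 0 := ⟨hφ, h⟩
      rw [(consistent_truth hcl).eq_backs 0 i, zero_add] at h0
      exact backs_mono w le_rfl le_rfl
        ((hsafe hi).trans (Set.iInter_subset _ l)) 0 i h0
  · rintro ⟨X, -, Y, -, hXY, h⟩
    obtain ⟨i, hi⟩ := h.exists
    -- A single `i` suffices: the intersection over all `l` moves inside the first `i` backward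
    -- steps and turns their argument into the safe set at `i`.
    have h1 := mem_backs_iInter w (backs_cl_antitone w i) 0 i φ hi
    have h2 : safe cl X ∅ w i ⊆ truth cl w i := fun ψ hψ =>
      have hc : ψ ∈ cl := Set.mem_iInter.1 hψ 0
      ⟨hc, (sound_of_confirmed hcl hXY ψ hc).1 i hψ⟩
    have h3 := backs_mono w le_rfl le_rfl h2 0 i h1
    have h4 := (consistent_truth (w := w) hcl).eq_backs 0 i
    rw [zero_add] at h4
    rw [← h4] at h3
    exact h3.2

end PNF

/-! ### The parity automaton of a formula in negation normal form. -/

namespace PNF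

variable {AP : Type*}

/-- The set of subformulas. -/
def sub : PNF AP → Set (PNF AP)
  | const b => {const b}
  | lit a b => {lit a b}
  | and φ ψ => insert (and φ ψ) (φ.sub ∪ ψ.sub)
  | or φ ψ => insert (or φ ψ) (φ.sub ∪ ψ.sub)
  | next φ => insert (next φ) φ.sub
  | until_ φ ψ => insert (until_ φ ψ) (φ.sub ∪ ψ.sub)
  | release φ ψ => insert (release φ ψ) (φ.sub ∪ ψ.sub)

theorem mem_sub_self (φ : PNF AP) : φ ∈ φ.sub := by
  cases φ <;> simp [sub]

theorem sub_subset_of_mem {φ ψ : PNF AP} (h : ψ ∈ φ.sub) : ψ.sub ⊆ φ.sub := by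
  induction φ with
  | const b => rw [Set.mem_singleton_iff.1 h]
  | lit a b => rw [Set.mem_singleton_iff.1 h]
  | next χ h1 =>
    rcases h with rfl | h
    · exact le_rfl
    · exact (h1 h).trans (Set.subset_insert _ _)
  | and χ θ h1 h2 | or χ θ h1 h2 | until_ χ θ h1 h2 | release χ θ h1 h2 =>
    rcases h with rfl | h | h
    · exact le_rfl
    · exact ((h1 h).trans Set.subset_union_left).trans (Set.subset_insert _ _)
    · exact ((h2 h).trans Set.subset_union_right).trans (Set.subset_insert _ _)

theorem closed_sub (φ : PNF AP) : Closed φ.sub where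
  and χ θ h := ⟨sub_subset_of_mem h (by simp [sub, mem_sub_self]),
    sub_subset_of_mem h (by simp [sub, mem_sub_self])⟩
  or χ θ h := ⟨sub_subset_of_mem h (by simp [sub, mem_sub_self]),
    sub_subset_of_mem h (by simp [sub, mem_sub_self])⟩
  next χ h := sub_subset_of_mem h (by simp [sub, mem_sub_self])
  until_ χ θ h := ⟨sub_subset_of_mem h (by simp [sub, mem_sub_self]),
    sub_subset_of_mem h (by simp [sub, mem_sub_self])⟩
  release χ θ h := ⟨sub_subset_of_mem h (by simp [sub, mem_sub_self]),
    sub_subset_of_mem h (by simp [sub, mem_sub_self])⟩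

/-- The deterministic parity automaton of a formula in negation normal form. -/
theorem exists_dpa (φ : PNF AP) (hfin : φ.sub.Finite) :
    ∃ (Q : Type) (_ : Fintype Q) (A : DPA Q (Set AP)),
      (∀ w, w ∈ A.language ↔ Holds w φ 0) ∧
      Fintype.card Q ≤ 2 ^ 2 ^ (4 * φ.sub.ncard + 3) := by
  let cl := φ.sub
  let V := ↥(𝒫 cl)
  have : Finite ↥cl := hfin
  have : Finite V := hfin.finite_subsets
  let emp : V := ⟨∅, Set.empty_subset _⟩
  let top : V := ⟨cl, Set.Subset.rfl⟩
  let δ : V → V → Set AP → V → V := fun X Y σ S => ⟨back cl X.1 Y.1 σ S.1, fun _ h => h.1⟩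
  have hδ : ∀ X Y w i l S, (backs (δ X Y) w i l S).1 = backs (back cl X.1 Y.1) w i l S.1 := by
    intro X Y w i l S
    induction l generalizing S with
    | zero => rfl
    | succ l ih => exact ih _
  -- The three kinds of window detect: ψ is co-safe relative to Y; ψ violates safety relative to X;
  -- the formula itself is refuted after i exact steps from position 0 followed by safety relative
  -- to X. The last two must fire only finitely often.
  let W : (V × ↥cl) ⊕ (V × ↥cl) ⊕ V → Window V (Set AP) := fun k => match k with
    | Sum.inl (Y, ψ) => ⟨δ top Y, emp, {S | ψ.1 ∈ S.1}, fun _ p => p⟩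
    | Sum.inr (Sum.inl (X, ψ)) => ⟨δ X emp, top, {S | ψ.1 ∉ S.1}, fun _ p => p⟩
    -- Taking preimages makes the condition at time i the set of values from which i exact backward
    -- steps refute the formula at position 0.
    | Sum.inr (Sum.inr X) => ⟨δ X emp, top, {S | φ ∉ S.1}, fun σ p => {S | δ top emp σ S ∈ p}⟩
  let Acc : Set (Set ((V × ↥cl) ⊕ (V × ↥cl) ⊕ V)) := {I | ∃ X Y : V,
    (∀ ψ : ↥cl, ψ.1 ∈ X.1 → Sum.inl (Y, ψ) ∈ I) ∧
    (∀ ψ : ↥cl, ψ.1 ∈ Y.1 → Sum.inr (Sum.inl (X, ψ)) ∉ I) ∧ Sum.inr (Sum.inr X) ∉ I}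
  obtain ⟨Q, hQ, A, hA, hcard⟩ := exists_dpa_of_windows W Acc
  refine ⟨Q, hQ, A, fun w => ?_, ?_⟩
  · have hcond1 : ∀ Y ψ i, (W (Sum.inl (Y, ψ))).cond w i = {S | ψ.1 ∈ S.1} := by
      intro Y ψ i
      induction i with
      | zero => rfl
      | succ i ih => exact ih
    have hcond2 : ∀ X ψ i, (W (Sum.inr (Sum.inl (X, ψ)))).cond w i = {S | ψ.1 ∉ S.1} := by
      intro X ψ i
      induction i with
      | zero => rfl
      | succ i ih => exact ih
    have hcond3 : ∀ X i, (W (Sum.inr (Sum.inr X))).cond w i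
        = {S | φ ∉ backs (back cl cl ∅) w 0 i S.1} := by
      intro X i
      induction i with
      | zero => rfl
      | succ i ih =>
        change {S | δ top emp (w i) S ∈ (W (Sum.inr (Sum.inr X))).cond w i} = _
        rw [ih]
        simp only [backs, zero_add]
        rfl
    have key1 : ∀ (Y : V) (ψ : ↥cl), (∃ᶠ i in Filter.atTop, ∃ l,
        backs (W (Sum.inl (Y, ψ))).δ w i l (W (Sum.inl (Y, ψ))).v₀
          ∈ (W (Sum.inl (Y, ψ))).cond w i) ↔
        ∃ᶠ i in Filter.atTop, ψ.1 ∈ cosafe cl cl Y.1 w i := by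
      intro Y ψ
      simp only [hcond1, cosafe, Set.mem_iUnion]
      change (∃ᶠ i in Filter.atTop, ∃ l, ψ.1 ∈ (backs (δ top Y) w i l emp).1) ↔ _
      simp only [hδ]
      rfl
    have key2 : ∀ (X : V) (ψ : ↥cl), ¬ (∃ᶠ i in Filter.atTop, ∃ l,
        backs (W (Sum.inr (Sum.inl (X, ψ)))).δ w i l (W (Sum.inr (Sum.inl (X, ψ)))).v₀
          ∈ (W (Sum.inr (Sum.inl (X, ψ)))).cond w i) ↔
        ∀ᶠ i in Filter.atTop, ψ.1 ∈ safe cl X.1 ∅ w i := by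
      intro X ψ
      simp only [hcond2, safe, Set.mem_iInter]
      change ¬ (∃ᶠ i in Filter.atTop, ∃ l, ψ.1 ∉ (backs (δ X emp) w i l top).1) ↔ _
      simp only [hδ, Filter.not_frequently, not_exists, not_not]
      rfl
    have key3 : ∀ X : V, ¬ (∃ᶠ i in Filter.atTop, ∃ l,
        backs (W (Sum.inr (Sum.inr X))).δ w i l (W (Sum.inr (Sum.inr X))).v₀
          ∈ (W (Sum.inr (Sum.inr X))).cond w i) ↔
        ∀ᶠ i in Filter.atTop, ∀ l,
          φ ∈ backs (back cl cl ∅) w 0 i (backs (back cl X.1 ∅) w i l cl) := by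
      intro X
      simp only [hcond3]
      change ¬ (∃ᶠ i in Filter.atTop, ∃ l,
        φ ∉ backs (back cl cl ∅) w 0 i (backs (δ X emp) w i l top).1) ↔ _
      simp only [hδ, Filter.not_frequently, not_exists, not_not]
      rfl
    rw [hA, holds_iff_exists_confirmed hfin (closed_sub φ) φ (mem_sub_self φ)]
    constructor
    · rintro ⟨X, Y, h1, h2, h3⟩
      exact ⟨X.1, X.2, Y.1, Y.2, ⟨fun ψ hψ => (key1 Y ⟨ψ, X.2 hψ⟩).1 (h1 ⟨ψ, X.2 hψ⟩ hψ),
        fun ψ hψ => (key2 X ⟨ψ, Y.2 hψ⟩).1 (h2 ⟨ψ, Y.2 hψ⟩ hψ)⟩, (key3 X).1 h3⟩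
    · rintro ⟨X, hX, Y, hY, ⟨h1, h2⟩, h3⟩
      exact ⟨⟨X, hX⟩, ⟨Y, hY⟩, fun ψ hψ => (key1 ⟨Y, hY⟩ ψ).2 (h1 _ hψ),
        fun ψ hψ => (key2 ⟨X, hX⟩ ψ).2 (h2 _ hψ), (key3 ⟨X, hX⟩).2 h3⟩
  · set m := φ.sub.ncard with hm
    have hV : Nat.card V = 2 ^ m := Set.ncard_powerset cl hfin
    have hcl : Nat.card ↥cl = m := rfl
    have hK : Nat.card ((V × ↥cl) ⊕ (V × ↥cl) ⊕ V) ≤ 2 ^ (2 * m + 1) := by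
      rw [Nat.card_sum, Nat.card_sum, Nat.card_prod, hV, hcl]
      have h1 : m + 1 ≤ 2 ^ m := Nat.lt_two_pow_self
      calc 2 ^ m * m + (2 ^ m * m + 2 ^ m) ≤ 2 ^ m * (2 * (m + 1)) := by ring_nf; omega
        _ ≤ 2 ^ m * (2 * 2 ^ m) := by gcongr
        _ = 2 ^ (2 * m + 1) := by ring
    rw [hcard, hV]
    refine Nat.pow_le_pow_right (by norm_num) ?_
    calc _ ≤ 2 * 2 ^ m * 2 ^ (2 * m + 1) + 2 ^ (2 * m + 1) * 2 ^ (2 * m + 1) := by gcongr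
      _ = 2 ^ (3 * m + 2) + 2 ^ (4 * m + 2) := by ring
      _ ≤ 2 ^ (4 * m + 2) + 2 ^ (4 * m + 2) := by gcongr <;> omega
      _ = 2 ^ (4 * m + 3) := by ring

end PNF

/-! ### Translation into negation normal form. -/

namespace LTL

variable {AP : Type*}

/-- The negation normal form of `φ` (for `true`) or of its negation (for `false`). -/
def nnf : LTL AP → Bool → PNF AP
  | tt, b => .const b
  | ff, b => .const !b
  | atom a, b => .lit a b
  | neg φ, b => nnf φ !b
  | and φ ψ, true => .and (nnf φ true) (nnf ψ true)
  | and φ ψ, false => .or (nnf φ false) (nnf ψ false)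
  | or φ ψ, true => .or (nnf φ true) (nnf ψ true)
  | or φ ψ, false => .and (nnf φ false) (nnf ψ false)
  | next φ, b => .next (nnf φ b)
  | finally_ φ, true => .until_ (.const true) (nnf φ true)
  | finally_ φ, false => .release (.const false) (nnf φ false)
  | globally φ, true => .release (.const false) (nnf φ true)
  | globally φ, false => .until_ (.const true) (nnf φ false)
  | until_ φ ψ, true => .until_ (nnf φ true) (nnf ψ true)
  | until_ φ ψ, false => .release (nnf φ false) (nnf ψ false)

theorem holds_nnf (w : ℕ → Set AP) (φ : LTL AP) (b : Bool) (i : ℕ) :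
    PNF.Holds w (nnf φ b) i ↔ (φ.Sat (suffix w i) ↔ b = true) := by
  have hs : ∀ i k, suffix (suffix w i) k = suffix w (i + k) := by
    intro i k
    funext j
    simp [suffix, add_assoc]
  induction φ generalizing b i with
  | neg φ ih => cases b <;> simp [nnf, ih, Sat]
  | atom a => cases b <;> simp [nnf, PNF.Holds, Sat, suffix]
  | until_ φ ψ h1 h2 =>
    cases b
    · simp only [nnf, PNF.Holds, Sat, h1, h2, hs, Bool.false_eq_true, iff_false, not_exists,
        not_and, not_forall]
      refine forall_congr' fun k => ?_
      rw [← imp_iff_not_or]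
      simp
    · simp [nnf, PNF.Holds, Sat, h1, h2, hs]
  | and φ ψ h1 h2 => cases b <;> simp [nnf, PNF.Holds, Sat, h1, h2, ← imp_iff_not_or]
  | _ => cases b <;> simp_all [nnf, PNF.Holds, Sat]

theorem mem_subformulas_self (φ : LTL AP) : φ ∈ φ.subformulas := by
  cases φ <;> simp [subformulas]

/-- Every subformula arises from a subformula of φ with one of two polarities, except the constants
introduced for F and G; inserting `tt` accounts for these. -/
theorem sub_nnf_subset (φ : LTL AP) (b : Bool) : (nnf φ b).sub ⊆
    (fun x : LTL AP × Bool => nnf x.1 x.2) '' ((insert tt φ.subformulas) ×ˢ Set.univ) := by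
  have mono : ∀ {s t : Set (LTL AP)}, s ⊆ t →
      (fun x : LTL AP × Bool => nnf x.1 x.2) '' ((insert tt s) ×ˢ Set.univ) ⊆
      (fun x : LTL AP × Bool => nnf x.1 x.2) '' ((insert tt t) ×ˢ Set.univ) := fun h =>
    Set.image_mono (Set.prod_mono (Set.insert_subset_insert h) le_rfl)
  have self : ∀ (ψ : LTL AP) (b : Bool), nnf ψ b ∈
      (fun x : LTL AP × Bool => nnf x.1 x.2) '' ((insert tt ψ.subformulas) ×ˢ Set.univ) :=
    fun ψ b => ⟨(ψ, b), ⟨Or.inr ψ.mem_subformulas_self, trivial⟩, rfl⟩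
  have node : ∀ (ψ : LTL AP) (b : Bool) (t : Set (PNF AP)), (nnf ψ b).sub = insert (nnf ψ b) t →
      t ⊆ (fun x : LTL AP × Bool => nnf x.1 x.2) '' ((insert tt ψ.subformulas) ×ˢ Set.univ) →
      (nnf ψ b).sub ⊆
        (fun x : LTL AP × Bool => nnf x.1 x.2) '' ((insert tt ψ.subformulas) ×ˢ Set.univ) :=
    fun ψ b t h ht => h ▸ Set.insert_subset (self ψ b) ht
  have const : ∀ (s : Set (LTL AP)) (b : Bool), PNF.const b ∈
      (fun x : LTL AP × Bool => nnf x.1 x.2) '' ((insert tt s) ×ˢ Set.univ) :=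
    fun s b => ⟨(tt, b), ⟨Or.inl rfl, trivial⟩, rfl⟩
  induction φ generalizing b with
  | tt => exact Set.singleton_subset_iff.2 (const _ _)
  | ff => exact Set.singleton_subset_iff.2 (const _ _)
  | atom a => exact Set.singleton_subset_iff.2 (self (atom a) b)
  | neg φ ih => exact (ih !b).trans (mono (Set.subset_insert _ _))
  | next φ ih =>
    exact Set.insert_subset (self (next φ) b)
      ((ih b).trans (mono (Set.subset_insert _ _)))
  | and φ ψ h1 h2 | or φ ψ h1 h2 | until_ φ ψ h1 h2 =>
    have hsub := fun c => Set.union_subset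
      ((h1 c).trans (mono (Set.subset_union_left (t := ψ.subformulas))))
      ((h2 c).trans (mono (Set.subset_union_right (s := φ.subformulas))))
    cases b <;> exact node _ _ _ rfl ((hsub _).trans (mono (Set.subset_insert _ _)))
  | finally_ φ ih | globally φ ih =>
    have hsub := fun c d => Set.union_subset (Set.singleton_subset_iff.2
      (const φ.subformulas c)) (ih d)
    cases b <;> exact node _ _ _ rfl ((hsub _ _).trans (mono (Set.subset_insert _ _)))

theorem size_pos (φ : LTL AP) : 0 < φ.size :=
  (Set.ncard_pos φ.finite_subformulas).2 ⟨φ, φ.mem_subformulas_self⟩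

theorem finite_sub_nnf (φ : LTL AP) (b : Bool) : (nnf φ b).sub.Finite :=
  (((φ.finite_subformulas.insert tt).prod Set.finite_univ).image _).subset (sub_nnf_subset φ b)

theorem ncard_sub_nnf_le (φ : LTL AP) (b : Bool) : (nnf φ b).sub.ncard ≤ 4 * φ.size := by
  have hfin := (φ.finite_subformulas.insert tt).prod (Set.finite_univ (α := Bool))
  have h1 := Set.ncard_le_ncard (sub_nnf_subset φ b) (hfin.image _)
  have h2 := Set.ncard_image_le (f := fun x : LTL AP × Bool => nnf x.1 x.2) hfin
  have h3 := Set.ncard_insert_le tt φ.subformulas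
  rw [Set.ncard_prod, Set.ncard_univ, Nat.card_eq_fintype_card, Fintype.card_bool] at h2
  have h4 := φ.size_pos
  unfold size at h4 ⊢
  omega

end LTL

theorem theorem3 :
    ∃ C : ℕ, ∀ (AP : Type*) [Finite AP] (φ : LTL AP),
      ∃ (Q : Type) (_ : Fintype Q) (A : DPA Q (Set AP)),
        A.language = φ.language ∧ Fintype.card Q ≤ 2 ^ 2 ^ (C * φ.size) := by
  -- The normal form has m ≤ 4|φ| subformulas, so 4m + 3 ≤ 16|φ| + 3 ≤ 19|φ|, since |φ| ≥ 1.
  refine ⟨19, fun AP _ φ => ?_⟩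
  obtain ⟨Q, hQ, A, hA, hcard⟩ := PNF.exists_dpa (φ.nnf true) (φ.finite_sub_nnf true)
  refine ⟨Q, hQ, A, ?_, hcard.trans ?_⟩
  · ext w
    have hw : LTL.suffix w 0 = w := funext fun i => congrArg w (Nat.zero_add i)
    rw [hA, LTL.holds_nnf, hw]
    simp [LTL.language]
  · have h1 := φ.ncard_sub_nnf_le true
    have h2 := φ.size_pos
    exact Nat.pow_le_pow_right (by norm_num) (Nat.pow_le_pow_right (by norm_num) (by omega))
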